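/- Let $M$ be a smooth (Hausdorff) manifold of dimension $2n$ with an almost Kähler structure $(g,J,\omega)$: that is, $J$ is a smooth almost complex structure on $M$, $g$ is a smooth Riemannian metric with $g(JX,JY)=g(X,Y)$, and the $2$-form $\omega(X,Y)=g(JX,Y)$ satisfies $d\omega=0$. For a smooth $(1,0)$-form $\zeta$ (a complex $1$-form vanishing on the $(-i)$-eigenbundle $T^{0,1}M$ of $J$), let $\partial\zeta=(d\zeta)^{2,0}$ and $\overline\partial\zeta=(d\zeta)^{1,1}$ be the components of $d\zeta$ of type $(2,0)$ and $(1,1)$ with respect to $J$. Assume that $M$ admits a global unitary $(1,0)$-coframe, i.e. smooth $(1,0)$-forms $\zeta_1,\dots,\zeta_n$ on $M$ which at every point are dual to a basis $Z_1,\dots,Z_n$ of $T^{1,0}M$ (the $i$-eigenbundle of $J$) with $g(Z_i,\overline{Z_j})=\delta_{ij}$ ($g$ extended complex-bilinearly), such that $$\partial\zeta_i=\overline\partial\zeta_i=0,\qquad i=1,\dots,n.$$ Then $J$ is integrable, that is, its Nijenhuis tensor $N(X,Y)=[JX,JY]-J[JX,Y]-J[X,JY]-[X,Y]$ vanishes for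 all smooth vector fields $X,Y$ on $M$; hence $(M,g,J,\omega)$ is Kähler (that is, $J$ is integrable and $d\omega=0$). -/

import Mathlib

open Set Bundle Manifold
open scoped ContDiff TensorProduct

noncomputable section

namespace AlmostHermitian

/-! ### The exterior derivative on a manifold -/

section ExteriorDerivative

variable {E : Type*} [NormedAddCommGroup E] [NormedSpace ℝ E]
  {H : Type*} [TopologicalSpace H] (I : ModelWithCorners ℝ E H)
  {M : Type*} [TopologicalSpace M] [ChartedSpace H M]
  {F : Type*} [NormedAddCommGroup F] [NormedSpace ℝ F]

/-- The expression in the chart at `x₀` of an `F`-valued `k`-form `α` on `M`: the pullback of `α`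
by the inverse of the chart, a `k`-form on the model vector space. -/
def formInChart {k : ℕ} (α : ∀ x : M, TangentSpace I x [⋀^Fin k]→L[ℝ] F) (x₀ : M) :
    E → E [⋀^Fin k]→L[ℝ] F := fun y =>
  (α ((extChartAt I x₀).symm y)).compContinuousLinearMap
    (mfderivWithin 𝓘(ℝ, E) I (extChartAt I x₀).symm (range I) y)

/-- The exterior derivative `dα` of an `F`-valued `k`-form on `M`. At the point `x₀` it is computed
in the chart at `x₀`: write `α` in that chart, take the exterior derivative on the model vector
space, and pull the result back to `T_{x₀}M` by the chart. -/
def extD {k : ℕ} (α : ∀ x : M, TangentSpace I x [⋀^Fin k]→L[ℝ] F) (x₀ : M) :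
    TangentSpace I x₀ [⋀^Fin (k + 1)]→L[ℝ] F :=
  (extDerivWithin (formInChart I α x₀) (range I) (extChartAt I x₀ x₀) :
      E [⋀^Fin (k + 1)]→L[ℝ] F).compContinuousLinearMap
    (mfderiv I 𝓘(ℝ, E) (extChartAt I x₀) x₀)

end ExteriorDerivative

lemma update_one_pair {V : Type*} (u v w : V) : Function.update ![u, v] 1 w = ![u, w] := by
  ext i
  fin_cases i <;> rfl

lemma continuous_bilin_apply {E : Type*} [NormedAddCommGroup E] [NormedSpace ℝ E]
    (B : E →L[ℝ] E →L[ℝ] ℝ) (J : E →L[ℝ] E) :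
    Continuous fun v : Fin 2 → E => B (J (v 0)) (v 1) := by
  fun_prop

/-! ### Complexification of a real vector space, and types -/

section Complexification

/-- The base change `A ⊗ V` of a real vector space to a real algebra `A`. -/
abbrev ExtendScalars (A V : Type*) [CommRing A] [Algebra ℝ A] [AddCommGroup V] [Module ℝ V] :
    Type _ := A ⊗[ℝ] V

/-- The complexification `ℂ ⊗ V` of a real vector space. -/
abbrev Cplx (V : Type*) [AddCommGroup V] [Module ℝ V] : Type _ := ExtendScalars ℂ V

variable {V : Type*} [AddCommGroup V] [Module ℝ V]

/-- Complex conjugation `a ⊗ v ↦ conj a ⊗ v` on `ℂ ⊗ V`. -/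
def conjC : Cplx V →ₗ[ℝ] Cplx V :=
  LinearMap.rTensor V Complex.conjAe.toLinearMap

lemma conjC_tmul (a : ℂ) (v : V) :
    conjC (a ⊗ₜ[ℝ] v : Cplx V) = (starRingEnd ℂ a) ⊗ₜ[ℝ] v := by
  simp [conjC]

/-- The complex-linear extension to `ℂ ⊗ V` of a real-linear map `V → ℂ`. -/
def extendLin (f : V →ₗ[ℝ] ℂ) : Cplx V →ₗ[ℂ] ℂ :=
  f.liftBaseChange ℂ

lemma extendLin_tmul (f : V →ₗ[ℝ] ℂ) (a : ℂ) (v : V) :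
    extendLin f (a ⊗ₜ[ℝ] v) = a * f v := by
  simp [extendLin]

/-- The complex-bilinear extension to `ℂ ⊗ V` of a complex-valued real-bilinear map on `V`. -/
def extendBilin (B : V →ₗ[ℝ] V →ₗ[ℝ] ℂ) : Cplx V →ₗ[ℂ] Cplx V →ₗ[ℂ] ℂ :=
  LinearMap.liftBaseChange ℂ
    ((LinearMap.liftBaseChangeEquiv ℂ).toLinearMap.restrictScalars ℝ ∘ₗ B)

lemma extendBilin_tmul (B : V →ₗ[ℝ] V →ₗ[ℝ] ℂ) (a b : ℂ) (u v : V) :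
    extendBilin B (a ⊗ₜ[ℝ] u) (b ⊗ₜ[ℝ] v) = a * (b * B u v) := by
  simp [extendBilin]

/-- The complex-bilinear extension to `ℂ ⊗ V` of a complex-valued alternating `2`-form on `V`. -/
def extendTwoForm [TopologicalSpace V] (α : V [⋀^Fin 2]→L[ℝ] ℂ) :
    Cplx V →ₗ[ℂ] Cplx V →ₗ[ℂ] ℂ :=
  extendBilin <| LinearMap.mk₂ ℝ (fun u v => α ![u, v])
    (fun u u' v => by simpa using α.toMultilinearMap.cons_add ![v] u u')
    (fun c u v => by simpa using α.toMultilinearMap.cons_smul ![v] c u)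
    (fun u v v' => by
      have h := α.map_update_add ![u, 0] 1 v v'
      simpa [update_one_pair] using h)
    (fun c u v => by
      have h := α.map_update_smul ![u, 0] 1 c v
      simpa [update_one_pair] using h)

lemma extendTwoForm_tmul [TopologicalSpace V] (α : V [⋀^Fin 2]→L[ℝ] ℂ) (a b : ℂ) (u v : V) :
    extendTwoForm α (a ⊗ₜ[ℝ] u) (b ⊗ₜ[ℝ] v) = a * (b * α ![u, v]) := by
  simp [extendTwoForm, extendBilin_tmul]

section Types

variable (J : V →ₗ[ℝ] V)

/-- The complex-linear extension of `J` to `ℂ ⊗ V`. -/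
def extendEnd : Cplx V →ₗ[ℂ] Cplx V :=
  J.baseChange ℂ

lemma extendEnd_tmul (a : ℂ) (v : V) : extendEnd J (a ⊗ₜ[ℝ] v) = a ⊗ₜ[ℝ] J v := by
  simp [extendEnd]

/-- `V^{1,0}`, the eigenspace in `ℂ ⊗ V` of `J` for the eigenvalue `i`. -/
def space10 : Submodule ℂ (Cplx V) :=
  Module.End.eigenspace (extendEnd J) Complex.I

/-- `V^{0,1}`, the eigenspace in `ℂ ⊗ V` of `J` for the eigenvalue `-i`. -/
def space01 : Submodule ℂ (Cplx V) :=
  Module.End.eigenspace (extendEnd J) (-Complex.I)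

lemma mem_space10 (Z : Cplx V) : Z ∈ space10 J ↔ extendEnd J Z = Complex.I • Z :=
  Module.End.mem_eigenspace_iff

lemma mem_space01 (Z : Cplx V) : Z ∈ space01 J ↔ extendEnd J Z = -Complex.I • Z :=
  Module.End.mem_eigenspace_iff

/-- `Z ↦ (Z - i J Z) / 2`; if `J² = -1`, the projection onto `V^{1,0}` along `V^{0,1}`. -/
def proj10 : Cplx V →ₗ[ℂ] Cplx V :=
  (1 / 2 : ℂ) • (LinearMap.id - Complex.I • extendEnd J)

/-- `Z ↦ (Z + i J Z) / 2`; if `J² = -1`, the projection onto `V^{0,1}` along `V^{1,0}`. -/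
def proj01 : Cplx V →ₗ[ℂ] Cplx V :=
  (1 / 2 : ℂ) • (LinearMap.id + Complex.I • extendEnd J)

/-- The component of type `(2,0)` of a complex-valued `2`-form on `V`. -/
def part20 [TopologicalSpace V] (α : V [⋀^Fin 2]→L[ℝ] ℂ) : Cplx V →ₗ[ℂ] Cplx V →ₗ[ℂ] ℂ :=
  (extendTwoForm α).compl₁₂ (proj10 J) (proj10 J)

/-- The component of type `(1,1)` of a complex-valued `2`-form on `V`. -/
def part11 [TopologicalSpace V] (α : V [⋀^Fin 2]→L[ℝ] ℂ) : Cplx V →ₗ[ℂ] Cplx V →ₗ[ℂ] ℂ :=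
  (extendTwoForm α).compl₁₂ (proj10 J) (proj01 J)
    + (extendTwoForm α).compl₁₂ (proj01 J) (proj10 J)

end Types

end Complexification

/-! ### Almost Hermitian structures -/

variable {n : ℕ} {M : Type*} [TopologicalSpace M]
  [ChartedSpace (EuclideanSpace ℝ (Fin (2 * n))) M] [IsManifold (𝓡 (2 * n)) ∞ M]

variable (n M) in
/-- An almost Hermitian structure `(g, J)` on a smooth `2n`-dimensional manifold `M`: a smooth
Riemannian metric `g` and a smooth almost complex structure `J` preserving `g`. -/
structure Structure where
  /-- the Riemannian metric -/
  g : ContMDiffRiemannianMetric (𝓡 (2 * n)) ∞ (EuclideanSpace ℝ (Fin (2 * n)))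
    (fun x : M => TangentSpace (𝓡 (2 * n)) x)
  /-- the almost complex structure -/
  J : ∀ x : M, TangentSpace (𝓡 (2 * n)) x →L[ℝ] TangentSpace (𝓡 (2 * n)) x
  contMDiff_J : ContMDiff (𝓡 (2 * n))
    ((𝓡 (2 * n)).prod
      𝓘(ℝ, EuclideanSpace ℝ (Fin (2 * n)) →L[ℝ] EuclideanSpace ℝ (Fin (2 * n)))) ∞
    (fun x => TotalSpace.mk'
      (EuclideanSpace ℝ (Fin (2 * n)) →L[ℝ] EuclideanSpace ℝ (Fin (2 * n)))
      (E := fun x : M => TangentSpace (𝓡 (2 * n)) x →L[ℝ] TangentSpace (𝓡 (2 * n)) x) x (J x))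
  J_J : ∀ (x : M) (v : TangentSpace (𝓡 (2 * n)) x), J x (J x v) = -v
  g_J_J : ∀ (x : M) (v w : TangentSpace (𝓡 (2 * n)) x),
    g.inner x (J x v) (J x w) = g.inner x v w

namespace Structure

variable (S : Structure n M)

lemma g_J_self (x : M) (v : TangentSpace (𝓡 (2 * n)) x) : S.g.inner x (S.J x v) v = 0 := by
  have h := S.g_J_J x (S.J x v) v
  rw [S.J_J, map_neg, neg_apply, S.g.symm x v] at h
  linarith

/-- The fundamental form `ω(X, Y) = g(JX, Y)`. -/
def fundamentalForm (x : M) : TangentSpace (𝓡 (2 * n)) x [⋀^Fin 2]→L[ℝ] ℝ where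
  toFun v := S.g.inner x (S.J x (v 0)) (v 1)
  map_update_add' := by
    intro _ v i a b
    fin_cases i <;> simp [Function.update]
  map_update_smul' := by
    intro _ v i c a
    fin_cases i <;> simp [Function.update]
  cont := continuous_bilin_apply (E := EuclideanSpace ℝ (Fin (2 * n))) (S.g.inner x) (S.J x)
  map_eq_zero_of_eq' := by
    intro v i j hij hne
    have h01 : v 0 = v 1 := by
      fin_cases i <;> fin_cases j <;> simp_all
    change S.g.inner x (S.J x (v 0)) (v 1) = 0
    rw [h01]
    exact S.g_J_self x _

/-- `(g, J, ω)` is almost Kähler: `dω = 0`. -/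
def IsAlmostKahler : Prop :=
  ∀ x : M, extD (𝓡 (2 * n)) S.fundamentalForm x = 0

/-- The vector field `JX`. -/
def Jfield (X : ∀ x : M, TangentSpace (𝓡 (2 * n)) x) (x : M) : TangentSpace (𝓡 (2 * n)) x :=
  S.J x (X x)

/-- The Nijenhuis tensor `N(X, Y) = [JX, JY] - J[JX, Y] - J[X, JY] - [X, Y]`. -/
def nijenhuis (X Y : ∀ x : M, TangentSpace (𝓡 (2 * n)) x) (x : M) :
    TangentSpace (𝓡 (2 * n)) x :=
  VectorField.mlieBracket (𝓡 (2 * n)) (S.Jfield X) (S.Jfield Y) x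
    - S.J x (VectorField.mlieBracket (𝓡 (2 * n)) (S.Jfield X) Y x)
    - S.J x (VectorField.mlieBracket (𝓡 (2 * n)) X (S.Jfield Y) x)
    - VectorField.mlieBracket (𝓡 (2 * n)) X Y x

/-- `J` is integrable: `N(X, Y) = 0` for all smooth vector fields `X`, `Y` on `M`. -/
def IsIntegrable : Prop :=
  ∀ X Y : ∀ x : M, TangentSpace (𝓡 (2 * n)) x,
    ContMDiff (𝓡 (2 * n)) (𝓡 (2 * n)).tangent ∞
      (fun x => (⟨x, X x⟩ : TangentBundle (𝓡 (2 * n)) M)) →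
    ContMDiff (𝓡 (2 * n)) (𝓡 (2 * n)).tangent ∞
      (fun x => (⟨x, Y x⟩ : TangentBundle (𝓡 (2 * n)) M)) →
    ∀ x : M, S.nijenhuis X Y x = 0

/-- `(g, J, ω)` is Kähler: `J` is integrable and `dω = 0`. -/
def IsKahler : Prop :=
  S.IsIntegrable ∧ S.IsAlmostKahler

/-! ### Forms of type `(1,0)` and unitary coframes -/

/-- `T^{1,0}_x M`, the eigenspace of `J` in `ℂ ⊗ T_xM` for the eigenvalue `i`. -/
abbrev T10 (x : M) : Submodule ℂ (Cplx (TangentSpace (𝓡 (2 * n)) x)) :=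
  space10 (S.J x).toLinearMap

/-- `T^{0,1}_x M`, the eigenspace of `J` in `ℂ ⊗ T_xM` for the eigenvalue `-i`. -/
abbrev T01 (x : M) : Submodule ℂ (Cplx (TangentSpace (𝓡 (2 * n)) x)) :=
  space01 (S.J x).toLinearMap

/-- A smooth global `(1,0)`-form on `M`: a smooth complex-valued `1`-form whose complex-linear
extension vanishes on `T^{0,1}M`. -/
structure Form10 where
  /-- the value at each point, as a real-linear map `T_xM → ℂ` -/
  toFun : ∀ x : M, TangentSpace (𝓡 (2 * n)) x →L[ℝ] ℂ
  contMDiff : ContMDiff (𝓡 (2 * n))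
    ((𝓡 (2 * n)).prod 𝓘(ℝ, EuclideanSpace ℝ (Fin (2 * n)) →L[ℝ] ℂ)) ∞
    (fun x => TotalSpace.mk' (EuclideanSpace ℝ (Fin (2 * n)) →L[ℝ] ℂ)
      (E := fun x : M => TangentSpace (𝓡 (2 * n)) x →L[ℝ] ℂ) x (toFun x))
  type10 : ∀ x : M, ∀ Z ∈ S.T01 x, extendLin (toFun x).toLinearMap Z = 0

namespace Form10

variable {S} (ζ : S.Form10)

/-- The complex-linear extension of the `(1,0)`-form `ζ` to `ℂ ⊗ T_xM`. -/
def extend (x : M) : Cplx (TangentSpace (𝓡 (2 * n)) x) →ₗ[ℂ] ℂ :=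
  extendLin (ζ.toFun x).toLinearMap

/-- The exterior derivative `dζ` of a `(1,0)`-form. -/
def d (x : M) : TangentSpace (𝓡 (2 * n)) x [⋀^Fin 2]→L[ℝ] ℂ :=
  extD (𝓡 (2 * n))
    (fun y => ContinuousAlternatingMap.ofSubsingleton ℝ (TangentSpace (𝓡 (2 * n)) y) ℂ
      (0 : Fin 1) (ζ.toFun y)) x

/-- `∂ζ`, the `(2,0)`-part of `dζ`, for a `(1,0)`-form `ζ`. -/
def del (x : M) : Cplx (TangentSpace (𝓡 (2 * n)) x) →ₗ[ℂ]
    Cplx (TangentSpace (𝓡 (2 * n)) x) →ₗ[ℂ] ℂ :=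
  part20 (S.J x).toLinearMap (ζ.d x)

/-- `∂̄ζ`, the `(1,1)`-part of `dζ`, for a `(1,0)`-form `ζ`. -/
def delbar (x : M) : Cplx (TangentSpace (𝓡 (2 * n)) x) →ₗ[ℂ]
    Cplx (TangentSpace (𝓡 (2 * n)) x) →ₗ[ℂ] ℂ :=
  part11 (S.J x).toLinearMap (ζ.d x)

end Form10

/-- The complex-bilinear extension of `g` to `ℂ ⊗ T_xM`. -/
def gC (x : M) : Cplx (TangentSpace (𝓡 (2 * n)) x) →ₗ[ℂ]
    Cplx (TangentSpace (𝓡 (2 * n)) x) →ₗ[ℂ] ℂ :=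
  extendBilin <| LinearMap.mk₂ ℝ (fun u v => ((S.g.inner x u v : ℝ) : ℂ))
    (by simp) (by simp) (by simp) (by simp)

/-- `ζ₁, …, ζₙ` is a unitary `(1,0)`-coframe: at every point it is dual to a basis `Z₁, …, Zₙ` of
`T^{1,0}M` which is unitary, that is, `g(Z_i, conj Z_j) = δ_ij`. -/
def IsUnitaryCoframe (ζ : Fin n → S.Form10) : Prop :=
  ∀ x : M, ∃ Z : Module.Basis (Fin n) ℂ (S.T10 x),
    (∀ i j, (ζ i).extend x (Z j) = if i = j then 1 else 0) ∧
    ∀ i j, S.gC x (Z i) (conjC (Z j : Cplx (TangentSpace (𝓡 (2 * n)) x))) =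
      if i = j then 1 else 0

end Structure

end AlmostHermitian

end

/-!
Let `X_u` be the frame dual to `ζ = (ζ₁, …, ζₙ) : TM → ℂⁿ`, `u ∈ ℂⁿ`, and `τ(u, v) = ζ[X_u, X_v]`
its structure functions. Since `dζ(X_u, X_v) = -τ(u, v)`, the hypothesis `∂ζ = ∂̄ζ = 0` says that
`τ` is conjugate-linear in each argument. In the Jacobi identity
`∑_cyc (X_u τ(v, w) + τ(u, τ(v, w))) = 0` the term `τ(w, τ(u, v))` is then the only one which is
complex linear in `u` and `v`, so it vanishes. On the other hand `dω = 0` amounts to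
`∑_cyc ⟨w, τ(u, v)⟩ = 0`: conjugate-linearity in `u` upgrades the vanishing of the imaginary part.
For `w = τ(u, v)` the identity `τ(·, τ(·, ·)) = 0` leaves `|τ(u, v)|² = 0`. Hence `dζᵢ = 0` for all
`i`, and evaluating the closed `(1, 0)`-forms `ζᵢ` on the Nijenhuis tensor gives `N = 0`.
-/

namespace AlmostHermitian

section ExteriorDerivative

open Topology VectorField

variable {E : Type*} [NormedAddCommGroup E] [NormedSpace ℝ E]
  {H : Type*} [TopologicalSpace H] (I : ModelWithCorners ℝ E H)
  {M : Type*} [TopologicalSpace M] [ChartedSpace H M]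
  {F : Type*} [NormedAddCommGroup F] [NormedSpace ℝ F]

lemma mvfderiv_eq_fderivWithin_comp_extChartAt_symm {f : M → F} {x : M}
    (hf : MDifferentiableAt I 𝓘(ℝ, F) f x) :
    mvfderiv I f x = fderivWithin ℝ (f ∘ (extChartAt I x).symm) (range I) (extChartAt I x x) := by
  have h : mfderiv I 𝓘(ℝ, F) f x = fderivWithin ℝ (writtenInExtChartAt I 𝓘(ℝ, F) x f) (range I)
      (extChartAt I x x) := if_pos hf
  rw [mvfderiv, h]
  rfl

lemma formInChart_apply_mpullbackWithin [IsManifold I 1 M] {k : ℕ}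
    (α : ∀ x : M, TangentSpace I x [⋀^Fin k]→L[ℝ] F) (V : Fin k → ∀ x : M, TangentSpace I x)
    {x : M} {y : E} (hy : y ∈ (extChartAt I x).target) :
    formInChart I α x y (fun j => mpullbackWithin 𝓘(ℝ, E) I (extChartAt I x).symm (V j)
      (range I) y) = α ((extChartAt I x).symm y) fun j => V j ((extChartAt I x).symm y) := by
  have h := isInvertible_mfderivWithin_extChartAt_symm (I := I) hy
  exact congrArg (α _) (funext fun j => h.self_apply_inverse _)

lemma mpullbackWithin_extChartAt_symm_self [IsManifold I 1 M] (V : ∀ x : M, TangentSpace I x)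
    (x : M) : mpullbackWithin 𝓘(ℝ, E) I (extChartAt I x).symm V (range I) (extChartAt I x x) =
      V x := by
  rw [mpullbackWithin_apply, extChartAt_to_inv]
  exact mfderivWithin_extChartAt_symm_inverse_apply (V x)

lemma formInChart_self [IsManifold I 1 M] {k : ℕ}
    (α : ∀ x : M, TangentSpace I x [⋀^Fin k]→L[ℝ] F) (x : M) :
    formInChart I α x (extChartAt I x x) = α x := by
  rw [formInChart, mfderivWithin_range_extChartAt_symm, extChartAt_to_inv]
  rfl

lemma extD_apply [IsManifold I 1 M] {k : ℕ} (α : ∀ x : M, TangentSpace I x [⋀^Fin k]→L[ℝ] F)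
    (x : M) : extD I α x = extDerivWithin (formInChart I α x) (range I) (extChartAt I x x) := by
  rw [extD, mfderiv_extChartAt_self]
  rfl

lemma mlieBracket_apply [IsManifold I 1 M] (V W : ∀ x : M, TangentSpace I x) (x : M) :
    mlieBracket I V W x =
      lieBracketWithin ℝ (mpullbackWithin 𝓘(ℝ, E) I (extChartAt I x).symm V (range I))
        (mpullbackWithin 𝓘(ℝ, E) I (extChartAt I x).symm W (range I)) (range I)
        (extChartAt I x x) := by
  rw [← mlieBracketWithin_univ, mlieBracketWithin_apply, mfderiv_extChartAt_self, preimage_univ,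
    univ_inter]
  exact DFunLike.congr_fun ContinuousLinearMap.inverse_id _

variable {I} [IsManifold I 2 M] [CompleteSpace E] {k : ℕ} {x : M}

lemma differentiableWithinAt_mpullbackWithin_extChartAt_symm {V : ∀ x : M, TangentSpace I x}
    (hV : MDifferentiableAt I I.tangent (T% V) x) :
    DifferentiableWithinAt ℝ (mpullbackWithin 𝓘(ℝ, E) I (extChartAt I x).symm V (range I))
      (range I) (extChartAt I x x) := by
  simpa only [preimage_univ, univ_inter] using
    (mdifferentiableWithinAt_univ.2 hV).differentiableWithinAt_mpullbackWithin_vectorField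

lemma mvfderiv_form_apply {α : ∀ x : M, TangentSpace I x [⋀^Fin k]→L[ℝ] F}
    {V : Fin k → ∀ x : M, TangentSpace I x}
    (hα : DifferentiableWithinAt ℝ (formInChart I α x) (range I) (extChartAt I x x))
    (hV : ∀ i, MDifferentiableAt I I.tangent (T% (V i)) x) :
    mvfderiv I (fun y => α y (V · y)) x =
      fderivWithin ℝ (fun y => formInChart I α x y fun j =>
        mpullbackWithin 𝓘(ℝ, E) I (extChartAt I x).symm (V j) (range I) y)
        (range I) (extChartAt I x x) := by
  have : IsManifold I 1 M := .of_le (n := 2) one_le_two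
  have hchart : (fun y => α y (V · y)) ∘ (extChartAt I x).symm =ᶠ[𝓝[range I] extChartAt I x x]
      fun y => formInChart I α x y fun j =>
        mpullbackWithin 𝓘(ℝ, E) I (extChartAt I x).symm (V j) (range I) y := by
    filter_upwards [extChartAt_target_mem_nhdsWithin x] with y hy
    exact (formInChart_apply_mpullbackWithin I α V hy).symm
  have hx := hchart.self_of_nhdsWithin
    (extChartAt_target_subset_range x (mem_extChartAt_target x))
  have hdiff : DifferentiableWithinAt ℝ ((fun y => α y (V · y)) ∘ (extChartAt I x).symm) (range I)
      (extChartAt I x x) :=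
    (hα.continuousAlternatingMap_apply fun j =>
      differentiableWithinAt_mpullbackWithin_extChartAt_symm (hV j)).congr_of_eventuallyEq
        hchart hx
  have hmdiff : MDifferentiableAt I 𝓘(ℝ, F) (fun y => α y (V · y)) x := by
    rw [← mdifferentiableWithinAt_univ]
    apply DifferentiableWithinAt.mdifferentiableWithinAt_of_comp_extChartAt_symm
    rwa [preimage_univ, univ_inter]
  rw [mvfderiv_eq_fderivWithin_comp_extChartAt_symm I hmdiff, hchart.fderivWithin_eq hx]

theorem extD_apply_vectorField {α : ∀ x : M, TangentSpace I x [⋀^Fin (k + 1)]→L[ℝ] F}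
    {V : Fin (k + 2) → ∀ x : M, TangentSpace I x}
    (hα : DifferentiableWithinAt ℝ (formInChart I α x) (range I) (extChartAt I x x))
    (hV : ∀ i, MDifferentiableAt I I.tangent (T% (V i)) x) :
    extD I α x (V · x) =
      (∑ i, (-1) ^ i.val • mvfderiv I (fun y => α y (i.removeNth (V · y))) x (V i x)) -
        ∑ i : Fin (k + 1), ∑ j ≥ i, (-1) ^ (i + j : ℕ) •
          α x (Matrix.vecCons (mlieBracket I (V i.castSucc) (V j.succ) x)
            (j.removeNth <| i.castSucc.removeNth (V · x))) := by
  have : IsManifold I 1 M := .of_le (n := 2) one_le_two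
  have hderiv : ∀ i : Fin (k + 2), mvfderiv I (fun y => α y (i.removeNth (V · y))) x = _ := fun i =>
    mvfderiv_form_apply hα fun j => hV (i.succAbove j)
  have hcartan := extDerivWithin_apply_vectorField hα
    (fun i => differentiableWithinAt_mpullbackWithin_extChartAt_symm (hV i))
    I.uniqueDiffWithinAt_image
  simp only [mpullbackWithin_extChartAt_symm_self, formInChart_self] at hcartan
  simp only [extD_apply, hderiv, mlieBracket_apply]
  exact hcartan

end ExteriorDerivative

section LieBracket

open VectorField

variable {E : Type*} [NormedAddCommGroup E] [NormedSpace ℝ E] [CompleteSpace E]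
  {H : Type*} [TopologicalSpace H] {I : ModelWithCorners ℝ E H}
  {M : Type*} [TopologicalSpace M] [ChartedSpace H M] [IsManifold I 3 M]
  {X Y Z : ∀ x : M, TangentSpace I x} {x : M}

lemma contMDiffAt_mlieBracket
    (hX : ContMDiffAt I I.tangent 2 (T% X) x)
    (hY : ContMDiffAt I I.tangent 2 (T% Y) x) :
    ContMDiffAt I I.tangent 1 (T% (mlieBracket I X Y)) x := by
  have : IsManifold I ((2 : ℕ∞) + 1) M := by convert! ‹IsManifold I 3 M›
  have : IsManifold I (minSmoothness ℝ 2) M := .of_le (n := 3) (by simp; norm_num)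
  exact ContMDiffAt.mlieBracket_vectorField (n := 2) (m := 1) hX hY (by simp; norm_num)

lemma mlieBracket_mlieBracket_cyclic
    (hX : ContMDiffAt I I.tangent 2 (T% X) x)
    (hY : ContMDiffAt I I.tangent 2 (T% Y) x)
    (hZ : ContMDiffAt I I.tangent 2 (T% Z) x) :
    mlieBracket I X (mlieBracket I Y Z) x + mlieBracket I Y (mlieBracket I Z X) x +
      mlieBracket I Z (mlieBracket I X Y) x = 0 := by
  have : IsManifold I 2 M := .of_le (n := 3) (by norm_num)
  have : IsManifold I (minSmoothness ℝ 3) M := by simpa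
  have hbracket := (contMDiffAt_mlieBracket hZ hX).mdifferentiableAt one_ne_zero
  have hswap : mlieBracket I Y (mlieBracket I X Z) x = -mlieBracket I Y (mlieBracket I Z X) x := by
    rw [mlieBracket_swap (V := X), ← neg_one_smul ℝ (mlieBracket I Z X),
      mlieBracket_const_smul_right hbracket, neg_one_smul]
  have hleibniz := leibniz_identity_mlieBracket_apply (I := I) (U := X) (V := Y) (W := Z) (x := x)
    (by simpa) (by simpa) (by simpa)
  rw [hleibniz, mlieBracket_swap_apply (V := mlieBracket I X Y), hswap]
  abel

end LieBracket

noncomputable section OneForms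

open Topology VectorField

variable {E : Type*} [NormedAddCommGroup E] [NormedSpace ℝ E]
  {H : Type*} [TopologicalSpace H] (I : ModelWithCorners ℝ E H)
  {M : Type*} [TopologicalSpace M] [ChartedSpace H M]
  {W : Type*} [NormedAddCommGroup W] [NormedSpace ℝ W]
  {F : Type*} [NormedAddCommGroup F] [NormedSpace ℝ F]

/-- A `W`-valued one-form on `M` as a section of the bundle `Hom(TM, W)`, the form in which its
smoothness is stated. -/
abbrev oneFormSection (a : ∀ x : M, TangentSpace I x →L[ℝ] W) (x : M) :
    TotalSpace (E →L[ℝ] W) fun x : M => TangentSpace I x →L[ℝ] W :=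
  ⟨x, a x⟩

/-- The expression in the chart at `x₀` of a `W`-valued one-form on `M`. -/
def oneFormInChart (a : ∀ x : M, TangentSpace I x →L[ℝ] W) (x₀ : M) (y : E) : E →L[ℝ] W :=
  (a ((extChartAt I x₀).symm y)).comp
    (mfderivWithin 𝓘(ℝ, E) I (extChartAt I x₀).symm (range I) y)

variable {I} {a : ∀ x : M, TangentSpace I x →L[ℝ] W} {x₀ : M}

lemma contMDiffAt_oneFormSection_iff [IsManifold I 1 M] {m : ℕ∞ω} :
    ContMDiffAt I (I.prod 𝓘(ℝ, E →L[ℝ] W)) m (oneFormSection I a) x₀ ↔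
      ContMDiffAt I 𝓘(ℝ, E →L[ℝ] W) m
        (fun x => (a x).comp ((trivializationAt E (TangentSpace I) x₀).symmL ℝ x)) x₀ := by
  refine (contMDiffAt_hom_bundle _).trans ((and_iff_right contMDiffAt_id).trans ?_)
  simp [ContinuousLinearMap.inCoordinates]

lemma mdifferentiableAt_oneFormSection_iff [IsManifold I 1 M] :
    MDifferentiableAt I (I.prod 𝓘(ℝ, E →L[ℝ] W)) (oneFormSection I a) x₀ ↔
      MDifferentiableAt I 𝓘(ℝ, E →L[ℝ] W)
        (fun x => (a x).comp ((trivializationAt E (TangentSpace I) x₀).symmL ℝ x)) x₀ := by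
  refine (mdifferentiableAt_hom_bundle _).trans ((and_iff_right mdifferentiableAt_id).trans ?_)
  simp [ContinuousLinearMap.inCoordinates]

lemma differentiableWithinAt_oneFormInChart [IsManifold I 1 M]
    (ha : MDifferentiableAt I (I.prod 𝓘(ℝ, E →L[ℝ] W)) (oneFormSection I a) x₀) :
    DifferentiableWithinAt ℝ (oneFormInChart I a x₀) (range I) (extChartAt I x₀ x₀) := by
  have h := (mdifferentiableWithinAt_univ.2
    (mdifferentiableAt_oneFormSection_iff.1 ha)).differentiableWithinAt_comp_extChartAt_symm
  rw [preimage_univ, univ_inter] at h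
  have heq : oneFormInChart I a x₀ =ᶠ[𝓝[range I] extChartAt I x₀ x₀]
      (fun x => (a x).comp ((trivializationAt E (TangentSpace I) x₀).symmL ℝ x)) ∘
        (extChartAt I x₀).symm := by
    filter_upwards [extChartAt_target_mem_nhdsWithin x₀] with y hy
    have hy' : (extChartAt I x₀).symm y ∈ (chartAt H x₀).source := by
      rw [← extChartAt_source I]
      exact (extChartAt I x₀).map_target hy
    rw [oneFormInChart, Function.comp_apply, TangentBundle.symmL_trivializationAt hy',
      (extChartAt I x₀).right_inv hy]
  exact h.congr_of_eventuallyEq heq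
    (heq.self_of_nhdsWithin (extChartAt_target_subset_range x₀ (mem_extChartAt_target x₀)))

lemma differentiableWithinAt_formInChart_compContinuousLinearMap [IsManifold I 1 M] {k : ℕ}
    (Ω : W [⋀^Fin k]→L[ℝ] F)
    (ha : MDifferentiableAt I (I.prod 𝓘(ℝ, E →L[ℝ] W)) (oneFormSection I a) x₀) :
    DifferentiableWithinAt ℝ (formInChart I (fun x => Ω.compContinuousLinearMap (a x)) x₀) (range I)
      (extChartAt I x₀ x₀) :=
  (differentiableWithinAt_const Ω).continuousAlternatingMapCompContinuousLinearMap
    (differentiableWithinAt_oneFormInChart ha)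

variable [IsManifold I 2 M] [CompleteSpace E] {X Y Z : ∀ x : M, TangentSpace I x}

theorem apply_mlieBracket
    (ha : MDifferentiableAt I (I.prod 𝓘(ℝ, E →L[ℝ] W)) (oneFormSection I a) x₀)
    (hX : MDifferentiableAt I I.tangent (T% X) x₀)
    (hY : MDifferentiableAt I I.tangent (T% Y) x₀) :
    a x₀ (mlieBracket I X Y x₀) =
      mvfderiv I (fun x => a x (Y x)) x₀ (X x₀) - mvfderiv I (fun x => a x (X x)) x₀ (Y x₀) -
        extD I (fun x => ContinuousAlternatingMap.ofSubsingleton ℝ (TangentSpace I x) W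
          (0 : Fin 1) (a x)) x₀ ![X x₀, Y x₀] := by
  have : IsManifold I 1 M := .of_le (n := 2) one_le_two
  have hα : DifferentiableWithinAt ℝ (formInChart I (fun x =>
      ContinuousAlternatingMap.ofSubsingleton ℝ (TangentSpace I x) W (0 : Fin 1) (a x)) x₀)
      (range I) (extChartAt I x₀ x₀) :=
    differentiableWithinAt_formInChart_compContinuousLinearMap
      (ContinuousAlternatingMap.ofSubsingleton ℝ W W (0 : Fin 1) (.id ℝ W)) ha
  have h := extD_apply_vectorField (V := ![X, Y]) hα (Fin.forall_fin_two.2 ⟨hX, hY⟩)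
  have hpair : (fun i => ![X, Y] i x₀) = ![X x₀, Y x₀] := by
    ext i
    fin_cases i <;> rfl
  have hremove : ∀ y, a y (Fin.removeNth 1 (fun i => ![X, Y] i y) 0) = a y (X y) := fun _ => rfl
  have htail : ∀ y, a y (Fin.tail (fun i => ![X, Y] i y) 0) = a y (Y y) := fun _ => rfl
  rw [hpair] at h
  rw [eq_sub_iff_add_eq', ← eq_sub_iff_add_eq]
  simpa [Fin.sum_univ_succ, hremove, htail, sub_eq_add_neg] using h

theorem extD_two_apply_vectorField {Ω : ∀ x : M, TangentSpace I x [⋀^Fin 2]→L[ℝ] F}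
    (hΩ : DifferentiableWithinAt ℝ (formInChart I Ω x₀) (range I) (extChartAt I x₀ x₀))
    (hX : MDifferentiableAt I I.tangent (T% X) x₀)
    (hY : MDifferentiableAt I I.tangent (T% Y) x₀)
    (hZ : MDifferentiableAt I I.tangent (T% Z) x₀) :
    extD I Ω x₀ ![X x₀, Y x₀, Z x₀] =
      mvfderiv I (fun x => Ω x ![Y x, Z x]) x₀ (X x₀) -
        mvfderiv I (fun x => Ω x ![X x, Z x]) x₀ (Y x₀) +
        mvfderiv I (fun x => Ω x ![X x, Y x]) x₀ (Z x₀) -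
        (Ω x₀ ![mlieBracket I X Y x₀, Z x₀] - Ω x₀ ![mlieBracket I X Z x₀, Y x₀] +
          Ω x₀ ![mlieBracket I Y Z x₀, X x₀]) := by
  have h := extD_apply_vectorField (V := ![X, Y, Z]) hΩ
    (Fin.forall_fin_succ.2 ⟨hX, Fin.forall_fin_two.2 ⟨hY, hZ⟩⟩)
  have hv : ∀ y, (fun i => ![X, Y, Z] i y) = ![X y, Y y, Z y] := fun y => by
    ext i
    fin_cases i <;> rfl
  have hpair : ∀ (y : M) (u v w : TangentSpace I y), Fin.removeNth 1 ![u, v, w] = ![u, w] ∧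
      Fin.removeNth 2 ![u, v, w] = ![u, v] := fun y u v w => by
    constructor <;> ext i <;> fin_cases i <;> rfl
  have hsingle : ∀ u v : TangentSpace I x₀, Fin.removeNth 1 ![u, v] = ![u] := fun u v => by
    ext i
    fin_cases i
    rfl
  have hIci : Finset.Ici (1 : Fin 2) = {1} := rfl
  simp only [hv] at h
  simpa [Fin.sum_univ_succ, hpair, hsingle, hIci, sub_eq_add_neg, add_assoc] using h

/-- The vector field on which the invertible `W`-valued one-form `a` takes the constant value `u`:
a linear combination with constant coefficients of the frame dual to the coframe `a`. -/
def frameField (a : ∀ x : M, TangentSpace I x →L[ℝ] W) (u : W) (x : M) : TangentSpace I x :=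
  (a x).inverse u

omit [IsManifold I 2 M] [CompleteSpace E]

lemma apply_frameField {x : M} (ha : (a x).IsInvertible) (u : W) : a x (frameField a u x) = u :=
  ha.self_apply_inverse u

lemma frameField_apply {x : M} (ha : (a x).IsInvertible) (v : TangentSpace I x) :
    frameField a (a x v) x = v :=
  ha.inverse_apply_self v

lemma contMDiffAt_frameField [CompleteSpace E] [IsManifold I 1 M] {m : ℕ∞ω}
    (ha : ContMDiffAt I (I.prod 𝓘(ℝ, E →L[ℝ] W)) m (oneFormSection I a) x₀)
    (hinv : (a x₀).IsInvertible) (u : W) :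
    ContMDiffAt I I.tangent m (T% (frameField a u)) x₀ := by
  set e := trivializationAt E (TangentSpace I) x₀
  have hx₀ : x₀ ∈ e.baseSet := FiberBundle.mem_baseSet_trivializationAt' x₀
  have hcoord : ∀ x (hx : x ∈ e.baseSet), (a x).comp (e.symmL ℝ x) =
      (a x).comp ((e.continuousLinearEquivAt ℝ x hx).symm : E →L[ℝ] TangentSpace I x) :=
    fun x hx => by rw [e.symm_continuousLinearEquivAt_eq' hx]
  have hsmooth : ContMDiffAt I 𝓘(ℝ, W →L[ℝ] E) m
      (fun x => ((a x).comp (e.symmL ℝ x)).inverse) x₀ := by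
    have hinv' : ((a x₀).comp (e.symmL ℝ x₀)).IsInvertible := by
      rw [hcoord x₀ hx₀]
      exact hinv.comp ContinuousLinearMap.isInvertible_equiv
    exact hinv'.contDiffAt_map_inverse.contMDiffAt.comp x₀
      (contMDiffAt_oneFormSection_iff.1 ha)
  refine (contMDiffAt_section x₀).2
    ((hsmooth.clm_apply (contMDiffAt_const (c := u))).congr_of_eventuallyEq ?_)
  filter_upwards [e.open_baseSet.mem_nhds hx₀] with x hx
  rw [hcoord x hx, ContinuousLinearMap.inverse_comp_equiv]
  rfl

lemma mdifferentiableAt_frameField [CompleteSpace E] [IsManifold I 1 M]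
    (ha : ContMDiffAt I (I.prod 𝓘(ℝ, E →L[ℝ] W)) 1 (oneFormSection I a) x₀)
    (hinv : (a x₀).IsInvertible) (u : W) :
    MDifferentiableAt I I.tangent (T% (frameField a u)) x₀ :=
  (contMDiffAt_frameField ha hinv u).mdifferentiableAt one_ne_zero

end OneForms

section ConjugateBilinear

variable {W : Type*}

lemma smul_I_smul_I [AddCommGroup W] [Module ℂ W] (w : W) : Complex.I • Complex.I • w = -w := by
  rw [smul_smul, Complex.I_mul_I, neg_one_smul]

lemma apply_I_smul_right [AddCommGroup W] [Module ℂ W] {b : W → W → W}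
    (hb : ∀ u v, b (Complex.I • u) v = -(Complex.I • b u v)) (hswap : ∀ u v, b u v = -b v u)
    (u v : W) : b u (Complex.I • v) = -(Complex.I • b u v) := by
  rw [hswap, hb, hswap u v, smul_neg]

lemma apply_apply_eq_zero_of_bianchi [AddCommGroup W] [Module ℂ W] {b : W → W → W}
    {D : W → W → W → W}
    (hb : ∀ u v, b (Complex.I • u) v = -(Complex.I • b u v)) (hswap : ∀ u v, b u v = -b v u)
    (hD : ∀ u v w, D u (Complex.I • v) w = -(Complex.I • D u v w))
    (hDswap : ∀ u v w, D u v w = -D u w v)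
    (hbianchi : ∀ u v w, D u v w + D v w u + D w u v +
      (b u (b v w) + b v (b w u) + b w (b u v)) = 0) (u v w : W) : b w (b u v) = 0 := by
  have hb' := apply_I_smul_right hb hswap
  have hD' := fun u => apply_I_smul_right (hD u) (hDswap u)
  have hneg : ∀ u v, b u (-v) = -b u v := fun u v => by
    rw [← smul_I_smul_I v, hb', hb', smul_neg, neg_neg, smul_I_smul_I]
  -- The term `b w (b u v)` is complex linear in `u` and `v`, and conjugate-linear in `w`.
  have h₁ := hbianchi u v w
  have h₂ := congrArg (Complex.I • ·) (hbianchi (Complex.I • u) v w)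
  have h₃ := congrArg (Complex.I • ·) (hbianchi u (Complex.I • v) w)
  have h₄ := hbianchi (Complex.I • u) (Complex.I • v) w
  simp only [hb, hb', hneg, hD, hD', smul_add, smul_neg, smul_I_smul_I, smul_zero, neg_neg]
    at h₁ h₂ h₃ h₄
  have h : (4 : ℂ) • b w (b u v) = 0 := by
    linear_combination (norm := module) h₁ - h₂ - h₃ - h₄
  exact (smul_eq_zero.1 h).resolve_left (by norm_num)

variable [NormedAddCommGroup W] [InnerProductSpace ℂ W]

lemma inner_cyclic_eq_zero_of_im_eq_zero {b : W → W → W}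
    (hb : ∀ u v, b (Complex.I • u) v = -(Complex.I • b u v)) (hswap : ∀ u v, b u v = -b v u)
    (him : ∀ u v w, (inner ℂ w (b u v) + inner ℂ u (b v w) + inner ℂ v (b w u)).im = 0)
    (u v w : W) : inner ℂ w (b u v) + inner ℂ u (b v w) + inner ℂ v (b w u) = 0 := by
  have h := him (Complex.I • u) v w
  have hI : inner ℂ w (b (Complex.I • u) v) + inner ℂ (Complex.I • u) (b v w) +
      inner ℂ v (b w (Complex.I • u)) =
      -(Complex.I * (inner ℂ w (b u v) + inner ℂ u (b v w) + inner ℂ v (b w u))) := by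
    rw [hb, apply_I_smul_right hb hswap]
    simp only [inner_neg_right, inner_smul_right, inner_smul_left, Complex.conj_I]
    ring
  rw [hI, Complex.neg_im, Complex.I_mul_im, neg_eq_zero] at h
  exact Complex.ext h (him u v w)

theorem conjBilinear_eq_zero_of_bianchi {b : W → W → W} {D : W → W → W → W}
    (hb : ∀ u v, b (Complex.I • u) v = -(Complex.I • b u v)) (hswap : ∀ u v, b u v = -b v u)
    (hD : ∀ u v w, D u (Complex.I • v) w = -(Complex.I • D u v w))
    (hDswap : ∀ u v w, D u v w = -D u w v)
    (hbianchi : ∀ u v w, D u v w + D v w u + D w u v +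
      (b u (b v w) + b v (b w u) + b w (b u v)) = 0)
    (him : ∀ u v w, (inner ℂ w (b u v) + inner ℂ u (b v w) + inner ℂ v (b w u)).im = 0)
    (u v : W) : b u v = 0 := by
  have hbb := apply_apply_eq_zero_of_bianchi hb hswap hD hDswap hbianchi
  have h := inner_cyclic_eq_zero_of_im_eq_zero hb hswap him u v (b u v)
  rw [hbb, hswap (b u v) u, hbb] at h
  simpa using h

end ConjugateBilinear

noncomputable section StructureFunctions

open VectorField

variable {E : Type*} [NormedAddCommGroup E] [NormedSpace ℝ E] [CompleteSpace E]
  {H : Type*} [TopologicalSpace H] (I : ModelWithCorners ℝ E H)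
  {M : Type*} [TopologicalSpace M] [ChartedSpace H M]
  {W : Type*} [NormedAddCommGroup W] [NormedSpace ℝ W]
  {F : Type*} [NormedAddCommGroup F] [NormedSpace ℝ F]

/-- The structure function `a([X_u, X_v])` of the coframe `a`, where `X_u = frameField a u`. For a
basis `(e_i)` of `W` the components of `structureFunction I a (e_i) (e_j)` are the structure
functions `c_ij^k` of the frame dual to `a`. -/
def structureFunction (a : ∀ x : M, TangentSpace I x →L[ℝ] W) (u v : W) (x : M) : W :=
  a x (mlieBracket I (frameField a u) (frameField a v) x)

variable {I} {a : ∀ x : M, TangentSpace I x →L[ℝ] W}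

omit [CompleteSpace E] in
lemma structureFunction_swap (u v : W) (x : M) :
    structureFunction I a u v x = -structureFunction I a v u x := by
  rw [structureFunction, mlieBracket_swap_apply, map_neg, structureFunction]

omit [CompleteSpace E] in
lemma mlieBracket_frameField (hinv : ∀ x, (a x).IsInvertible) (u v : W) (x : M) :
    mlieBracket I (frameField a u) (frameField a v) x =
      frameField a (structureFunction I a u v x) x :=
  (frameField_apply (hinv x) _).symm

omit [CompleteSpace E] in
lemma mvfderiv_apply_frameField (hinv : ∀ x, (a x).IsInvertible) (u : W) (x : M) :
    mvfderiv I (fun y => a y (frameField a u y)) x = 0 := by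
  simp only [fun y => apply_frameField (hinv y) u, mvfderiv_const]

lemma extD_apply_frameField [IsManifold I 2 M]
    (ha : ContMDiff I (I.prod 𝓘(ℝ, E →L[ℝ] W)) 1 (oneFormSection I a))
    (hinv : ∀ x, (a x).IsInvertible) (u v : W) (x : M) :
    extD I (fun y => ContinuousAlternatingMap.ofSubsingleton ℝ (TangentSpace I y) W (0 : Fin 1)
      (a y)) x ![frameField a u x, frameField a v x] = -structureFunction I a u v x := by
  have : IsManifold I 1 M := .of_le (n := 2) one_le_two
  have hX := mdifferentiableAt_frameField (ha x) (hinv x)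
  have h := apply_mlieBracket ((ha x).mdifferentiableAt one_ne_zero) (hX u) (hX v)
  rw [mvfderiv_apply_frameField hinv, mvfderiv_apply_frameField hinv] at h
  simp only [zero_apply, sub_zero, zero_sub] at h
  rw [structureFunction, h, neg_neg]

lemma extD_compContinuousLinearMap_apply_frameField [IsManifold I 2 M]
    (ha : ContMDiff I (I.prod 𝓘(ℝ, E →L[ℝ] W)) 1 (oneFormSection I a))
    (hinv : ∀ x, (a x).IsInvertible) (Ω : W [⋀^Fin 2]→L[ℝ] F) (u v w : W) (x : M) :
    extD I (fun y => Ω.compContinuousLinearMap (a y)) x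
      ![frameField a u x, frameField a v x, frameField a w x] =
      -(Ω ![structureFunction I a u v x, w] - Ω ![structureFunction I a u w x, v] +
        Ω ![structureFunction I a v w x, u]) := by
  have : IsManifold I 1 M := .of_le (n := 2) one_le_two
  have hX := mdifferentiableAt_frameField (ha x) (hinv x)
  have hpair : ∀ (y : M) (X Y : TangentSpace I y),
      Ω.compContinuousLinearMap (a y) ![X, Y] = Ω ![a y X, a y Y] := fun y X Y => by
    rw [ContinuousAlternatingMap.compContinuousLinearMap_apply]
    congr 1
    ext i
    fin_cases i <;> rfl
  have h := extD_two_apply_vectorField (differentiableWithinAt_formInChart_compContinuousLinearMap Ω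
    ((ha x).mdifferentiableAt one_ne_zero)) (hX u) (hX v) (hX w)
  simp only [hpair, fun y => apply_frameField (hinv y), mvfderiv_const, zero_apply, sub_zero,
    add_zero, zero_sub] at h
  exact h

variable [IsManifold I 3 M]

lemma contMDiffAt_mlieBracket_frameField
    (ha : ContMDiff I (I.prod 𝓘(ℝ, E →L[ℝ] W)) 2 (oneFormSection I a))
    (hinv : ∀ x, (a x).IsInvertible) (u v : W) (x : M) :
    ContMDiffAt I I.tangent 1 (T% (mlieBracket I (frameField a u) (frameField a v))) x := by
  have : IsManifold I 1 M := .of_le (n := 3) (by norm_num)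
  exact contMDiffAt_mlieBracket (contMDiffAt_frameField (ha x) (hinv x) u)
    (contMDiffAt_frameField (ha x) (hinv x) v)

lemma mdifferentiableAt_structureFunction
    (ha : ContMDiff I (I.prod 𝓘(ℝ, E →L[ℝ] W)) 2 (oneFormSection I a))
    (hinv : ∀ x, (a x).IsInvertible) (u v : W) (x : M) :
    MDifferentiableAt I 𝓘(ℝ, W) (structureFunction I a u v) x := by
  have : IsManifold I 1 M := .of_le (n := 3) (by norm_num)
  have h := ((ha x).of_le one_le_two).clm_bundle_apply
    (contMDiffAt_mlieBracket_frameField ha hinv u v x)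
  exact (contMDiffAt_totalSpace.1 h).2.mdifferentiableAt one_ne_zero

lemma apply_mlieBracket_mlieBracket_frameField
    (ha : ContMDiff I (I.prod 𝓘(ℝ, E →L[ℝ] W)) 2 (oneFormSection I a))
    (hinv : ∀ x, (a x).IsInvertible) (u v w : W) (x : M) :
    a x (mlieBracket I (frameField a u) (mlieBracket I (frameField a v) (frameField a w)) x) =
      mvfderiv I (structureFunction I a v w) x (frameField a u x) +
        structureFunction I a u (structureFunction I a v w x) x := by
  have : IsManifold I 1 M := .of_le (n := 3) (by norm_num)
  have : IsManifold I 2 M := .of_le (n := 3) (by norm_num)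
  have hX := mdifferentiableAt_frameField ((ha x).of_le one_le_two) (hinv x) u
  rw [apply_mlieBracket ((ha x).mdifferentiableAt two_ne_zero) hX
    ((contMDiffAt_mlieBracket_frameField ha hinv v w x).mdifferentiableAt one_ne_zero),
    mvfderiv_apply_frameField hinv, mlieBracket_frameField hinv v w x,
    extD_apply_frameField (ha.of_le one_le_two) hinv, zero_apply, sub_zero, sub_neg_eq_add]
  rfl

theorem structureFunction_bianchi
    (ha : ContMDiff I (I.prod 𝓘(ℝ, E →L[ℝ] W)) 2 (oneFormSection I a))
    (hinv : ∀ x, (a x).IsInvertible) (u v w : W) (x : M) :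
    mvfderiv I (structureFunction I a v w) x (frameField a u x) +
      mvfderiv I (structureFunction I a w u) x (frameField a v x) +
      mvfderiv I (structureFunction I a u v) x (frameField a w x) +
      (structureFunction I a u (structureFunction I a v w x) x +
        structureFunction I a v (structureFunction I a w u x) x +
        structureFunction I a w (structureFunction I a u v x) x) = 0 := by
  have : IsManifold I 1 M := .of_le (n := 3) (by norm_num)
  have hX := fun z => contMDiffAt_frameField (ha x) (hinv x) z
  have h := congrArg (a x) (mlieBracket_mlieBracket_cyclic (hX u) (hX v) (hX w))
  simp only [map_add, map_zero, apply_mlieBracket_mlieBracket_frameField ha hinv] at h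
  rw [← h]
  abel

end StructureFunctions

noncomputable section HermitianCoframes

variable {E : Type*} [NormedAddCommGroup E] [NormedSpace ℝ E]
  {H : Type*} [TopologicalSpace H] {I : ModelWithCorners ℝ E H}
  {M : Type*} [TopologicalSpace M] [ChartedSpace H M]

lemma mvfderiv_clm_apply {F G : Type*} [NormedAddCommGroup F] [NormedSpace ℝ F]
    [NormedAddCommGroup G] [NormedSpace ℝ G] (L : F →L[ℝ] G) {f : M → F} {x : M}
    (hf : MDifferentiableAt I 𝓘(ℝ, F) f x) (v : TangentSpace I x) :
    mvfderiv I (fun y => L (f y)) x v = L (mvfderiv I f x v) := by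
  have h := mfderiv_comp x L.mdifferentiableAt hf
  rw [ContinuousLinearMap.mfderiv_eq] at h
  exact DFunLike.congr_fun h v

variable {W : Type*} [NormedAddCommGroup W] [InnerProductSpace ℂ W]

variable (W) in
/-- The fundamental form `ω(u, v) = g(iu, v)` of the real inner product `g = 2 Re ⟪·, ·⟫` on a
complex inner product space. With this normalisation the vectors `(e - i ⊗ ie) / 2` built from
orthonormal vectors `e` are unitary for the complex-bilinear extension of `g`. -/
def hermitianForm : W [⋀^Fin 2]→L[ℝ] ℝ where
  toFun v := 2 * (inner ℂ (v 0) (v 1)).im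
  map_update_add' := by
    intro _ v i a b
    fin_cases i <;> simp [Function.update, mul_add]
  map_update_smul' := by
    intro _ v i c a
    fin_cases i
    · simp [Function.update, inner_smul_left_eq_smul, mul_left_comm]
    · simp [Function.update, inner_smul_right_eq_smul, mul_left_comm]
  cont := by fun_prop
  map_eq_zero_of_eq' := by
    intro v i j hij hne
    have h01 : v 0 = v 1 := by
      fin_cases i <;> fin_cases j <;> simp_all
    rw [h01]
    exact mul_eq_zero_of_right 2 (inner_self_im (𝕜 := ℂ) (v 1))

lemma hermitianForm_apply (v : Fin 2 → W) :
    hermitianForm W v = 2 * (inner ℂ (v 0) (v 1)).im := rfl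

variable [CompleteSpace E] {a : ∀ x : M, TangentSpace I x →L[ℝ] W}

lemma im_inner_structureFunction_cyclic [IsManifold I 2 M]
    (ha : ContMDiff I (I.prod 𝓘(ℝ, E →L[ℝ] W)) 1 (oneFormSection I a))
    (hinv : ∀ x, (a x).IsInvertible) {x : M}
    (hΩ : extD I (fun y => (hermitianForm W).compContinuousLinearMap (a y)) x = 0) (u v w : W) :
    (inner ℂ w (structureFunction I a u v x) + inner ℂ u (structureFunction I a v w x) +
      inner ℂ v (structureFunction I a w u x)).im = 0 := by
  have h := extD_compContinuousLinearMap_apply_frameField ha hinv (hermitianForm W) u v w x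
  rw [hΩ, structureFunction_swap u w] at h
  simp only [ContinuousAlternatingMap.coe_zero, Pi.zero_apply, hermitianForm_apply,
    Matrix.cons_val_zero, Matrix.cons_val_one, inner_neg_left, Complex.neg_im] at h
  have hswap : ∀ p q : W, (inner ℂ p q).im = -(inner ℂ q p).im := inner_im_symm (𝕜 := ℂ)
  rw [Complex.add_im, Complex.add_im, hswap w, hswap u, hswap v]
  linarith

theorem structureFunction_eq_zero [IsManifold I 3 M]
    (ha : ContMDiff I (I.prod 𝓘(ℝ, E →L[ℝ] W)) 2 (oneFormSection I a))
    (hinv : ∀ x, (a x).IsInvertible)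
    (hconj : ∀ u v x, structureFunction I a (Complex.I • u) v x =
      -(Complex.I • structureFunction I a u v x))
    {x : M} (hΩ : extD I (fun y => (hermitianForm W).compContinuousLinearMap (a y)) x = 0)
    (u v : W) : structureFunction I a u v x = 0 := by
  have : IsManifold I 2 M := .of_le (n := 3) (by norm_num)
  refine conjBilinear_eq_zero_of_bianchi (b := fun u v => structureFunction I a u v x)
    (D := fun u v w => mvfderiv I (structureFunction I a v w) x (frameField a u x))
    (fun u v => hconj u v x) (fun u v => structureFunction_swap u v x) ?_ ?_
    (fun u v w => structureFunction_bianchi ha hinv u v w x)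
    (im_inner_structureFunction_cyclic (ha.of_le one_le_two) hinv hΩ) u v
  · intro u v w
    rw [funext (hconj v w)]
    exact mvfderiv_clm_apply (-(Complex.I • ContinuousLinearMap.id ℝ W))
      (mdifferentiableAt_structureFunction ha hinv v w x) _
  · intro u v w
    rw [funext (structureFunction_swap v w), mvfderiv_fun_neg]
    rfl

end HermitianCoframes

section Types

variable {V : Type*} [AddCommGroup V] [Module ℝ V] {J : V →ₗ[ℝ] V}

lemma proj10_add_proj01 (Z : Cplx V) : proj10 J Z + proj01 J Z = Z := by
  simp only [proj10, proj01, LinearMap.smul_apply, LinearMap.sub_apply, LinearMap.add_apply,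
    LinearMap.id_apply]
  module

lemma extendEnd_extendEnd (hJ : ∀ v, J (J v) = -v) (Z : Cplx V) :
    extendEnd J (extendEnd J Z) = -Z := by
  induction Z using TensorProduct.induction_on with
  | zero => simp only [map_zero, neg_zero]
  | tmul a v => rw [extendEnd_tmul, extendEnd_tmul, hJ, TensorProduct.tmul_neg]
  | add Z Z' hZ hZ' => rw [map_add, map_add, hZ, hZ', neg_add]

lemma proj10_mem_space10 (hJ : ∀ v, J (J v) = -v) (Z : Cplx V) : proj10 J Z ∈ space10 J := by
  rw [mem_space10]
  simp only [proj10, LinearMap.smul_apply, LinearMap.sub_apply, LinearMap.id_apply, map_smul,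
    map_sub, extendEnd_extendEnd hJ]
  linear_combination (norm := module) (1 / 2 : ℂ) • (congrArg (· • extendEnd J Z) Complex.I_mul_I)

lemma proj01_mem_space01 (hJ : ∀ v, J (J v) = -v) (Z : Cplx V) : proj01 J Z ∈ space01 J := by
  rw [mem_space01]
  simp only [proj01, LinearMap.smul_apply, LinearMap.add_apply, LinearMap.id_apply, map_smul,
    map_add, extendEnd_extendEnd hJ]
  linear_combination (norm := module) (1 / 2 : ℂ) • (congrArg (· • extendEnd J Z) Complex.I_mul_I)

lemma proj01_extendEnd (hJ : ∀ v, J (J v) = -v) (Z : Cplx V) :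
    proj01 J (extendEnd J Z) = -Complex.I • proj01 J Z := by
  rw [← (mem_space01 J _).1 (proj01_mem_space01 hJ Z)]
  simp only [proj01, LinearMap.smul_apply, LinearMap.add_apply, LinearMap.id_apply, map_smul,
    map_add]

lemma conjC_smul (a : ℂ) (Z : Cplx V) : conjC (a • Z) = starRingEnd ℂ a • conjC Z := by
  induction Z using TensorProduct.induction_on with
  | zero => simp only [smul_zero, map_zero]
  | tmul b v => simp only [TensorProduct.smul_tmul', conjC_tmul, smul_eq_mul, map_mul]
  | add Z Z' hZ hZ' => rw [smul_add, map_add, hZ, hZ', map_add, smul_add]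

lemma conjC_proj10_tmul (v : V) : conjC (proj10 J (1 ⊗ₜ[ℝ] v)) = proj01 J (1 ⊗ₜ[ℝ] v) := by
  simp [proj10, proj01, conjC_smul, conjC_tmul, extendEnd_tmul, Complex.conj_ofNat]

lemma apply_J_of_extendLin_eq_zero (hJ : ∀ v, J (J v) = -v) {f : V →ₗ[ℝ] ℂ}
    (hf : ∀ Z ∈ space01 J, extendLin f Z = 0) (v : V) : f (J v) = Complex.I * f v := by
  have h := hf _ (proj01_mem_space01 hJ (1 ⊗ₜ[ℝ] v))
  simp only [proj01, LinearMap.smul_apply, LinearMap.add_apply, LinearMap.id_apply, map_smul,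
    map_add, extendEnd_tmul, extendLin_tmul, smul_eq_mul, one_mul] at h
  linear_combination -2 * Complex.I * h + f (J v) * Complex.I_mul_I

lemma extendTwoForm_apply_of_part20_of_part11 [TopologicalSpace V] {α : V [⋀^Fin 2]→L[ℝ] ℂ}
    (h20 : part20 J α = 0) (h11 : part11 J α = 0) (Z Z' : Cplx V) :
    extendTwoForm α Z Z' = extendTwoForm α (proj01 J Z) (proj01 J Z') := by
  have h20' := LinearMap.congr_fun₂ h20 Z Z'
  have h11' := LinearMap.congr_fun₂ h11 Z Z'
  simp only [part20, part11, LinearMap.add_apply, LinearMap.compl₁₂_apply,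
    LinearMap.zero_apply] at h20' h11'
  conv_lhs => rw [← proj10_add_proj01 (J := J) Z, ← proj10_add_proj01 (J := J) Z']
  simp only [map_add, LinearMap.add_apply]
  linear_combination h20' + h11'

lemma apply_J_of_part20_of_part11 [TopologicalSpace V] (hJ : ∀ v, J (J v) = -v)
    {α : V [⋀^Fin 2]→L[ℝ] ℂ} (h20 : part20 J α = 0) (h11 : part11 J α = 0) (v w : V) :
    α ![J v, w] = -(Complex.I * α ![v, w]) := by
  have hα : ∀ v w, α ![v, w] =
      extendTwoForm α (proj01 J (1 ⊗ₜ[ℝ] v)) (proj01 J (1 ⊗ₜ[ℝ] w)) := fun v w => by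
    rw [← extendTwoForm_apply_of_part20_of_part11 h20 h11, extendTwoForm_tmul, one_mul, one_mul]
  rw [hα, hα, ← extendEnd_tmul, proj01_extendEnd hJ, map_smul, LinearMap.smul_apply, smul_eq_mul,
    neg_mul]

section UnitaryBasis

variable {ι : Type*} [Fintype ι] [DecidableEq ι] {ζ : ι → V →ₗ[ℝ] ℂ}

lemma proj10_tmul_eq_sum (hJ : ∀ v, J (J v) = -v)
    (hζ : ∀ i, ∀ Z ∈ space01 J, extendLin (ζ i) Z = 0) (Z : Module.Basis ι ℂ (space10 J))
    (hdual : ∀ i j, extendLin (ζ i) (Z j) = if i = j then 1 else 0) (v : V) :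
    proj10 J (1 ⊗ₜ[ℝ] v) = ∑ i, ζ i v • (Z i : Cplx V) := by
  set c := Z.repr ⟨_, proj10_mem_space10 hJ (1 ⊗ₜ[ℝ] v)⟩
  have hsum : ∑ i, c i • (Z i : Cplx V) = proj10 J (1 ⊗ₜ[ℝ] v) := by
    simpa only [map_sum, map_smul, Submodule.subtype_apply] using
      congrArg (Submodule.subtype _) (Z.sum_repr ⟨_, proj10_mem_space10 hJ (1 ⊗ₜ[ℝ] v)⟩)
  rw [← hsum]
  refine Finset.sum_congr rfl fun i _ => congrArg (· • (Z i : Cplx V)) ?_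
  have hζv := congrArg (extendLin (ζ i)) (proj10_add_proj01 (J := J) (1 ⊗ₜ[ℝ] v))
  rw [map_add, hζ i _ (proj01_mem_space01 hJ _), add_zero, extendLin_tmul, one_mul] at hζv
  simp [← hζv, ← hsum, hdual]

lemma extendBilin_proj10_proj01 (hJ : ∀ v, J (J v) = -v) {B : V →ₗ[ℝ] V →ₗ[ℝ] ℂ}
    (hB : ∀ v w, B (J v) (J w) = B v w) (v w : V) :
    extendBilin B (proj10 J (1 ⊗ₜ[ℝ] v)) (proj01 J (1 ⊗ₜ[ℝ] w)) =
      1 / 2 * (B v w + Complex.I * B v (J w)) := by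
  have hBJ : B (J v) w = -B v (J w) := by
    rw [← hB, hJ, map_neg, LinearMap.neg_apply]
  simp only [proj10, proj01, LinearMap.smul_apply, LinearMap.sub_apply, LinearMap.add_apply,
    LinearMap.id_apply, map_smul, map_add, map_sub, extendEnd_tmul, extendBilin_tmul, hB, hBJ,
    smul_eq_mul, one_mul]
  linear_combination (-1 / 4 : ℂ) * B v w * Complex.I_mul_I

lemma apply_add_I_mul_apply_J_of_unitary (hJ : ∀ v, J (J v) = -v) {B : V →ₗ[ℝ] V →ₗ[ℝ] ℂ}
    (hB : ∀ v w, B (J v) (J w) = B v w)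
    (hζ : ∀ i, ∀ Z ∈ space01 J, extendLin (ζ i) Z = 0) (Z : Module.Basis ι ℂ (space10 J))
    (hdual : ∀ i j, extendLin (ζ i) (Z j) = if i = j then 1 else 0)
    (hunit : ∀ i j, extendBilin B (Z i) (conjC (Z j : Cplx V)) = if i = j then 1 else 0)
    (v w : V) :
    B v w + Complex.I * B v (J w) = 2 * ∑ i, starRingEnd ℂ (ζ i w) * ζ i v := by
  have h := extendBilin_proj10_proj01 hJ hB v w
  rw [← conjC_proj10_tmul, proj10_tmul_eq_sum hJ hζ Z hdual v,
    proj10_tmul_eq_sum hJ hζ Z hdual w] at h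
  simp only [map_sum, conjC_smul, map_smul, LinearMap.sum_apply, LinearMap.smul_apply, hunit,
    smul_eq_mul, mul_ite, mul_one, mul_zero, Finset.sum_ite_eq',
    Finset.mem_univ, if_true] at h
  rw [h]
  ring

end UnitaryBasis

end Types

noncomputable section AlmostHermitianStructure

open VectorField

variable {n : ℕ} {M : Type*} [TopologicalSpace M]
  [ChartedSpace (EuclideanSpace ℝ (Fin (2 * n))) M] [IsManifold (𝓡 (2 * n)) ∞ M]
  {S : Structure n M}

namespace Structure

namespace Form10

variable (ζ : S.Form10)

lemma toFun_J (x : M) (v : TangentSpace (𝓡 (2 * n)) x) :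
    ζ.toFun x (S.J x v) = Complex.I * ζ.toFun x v :=
  apply_J_of_extendLin_eq_zero (J := (S.J x).toLinearMap) (S.J_J x) (ζ.type10 x) v

variable {ζ}

lemma d_apply_J {x : M} (hdel : ζ.del x = 0) (hdelbar : ζ.delbar x = 0)
    (v w : TangentSpace (𝓡 (2 * n)) x) :
    ζ.d x ![S.J x v, w] = -(Complex.I * ζ.d x ![v, w]) :=
  apply_J_of_part20_of_part11 (J := (S.J x).toLinearMap) (S.J_J x) hdel hdelbar v w

end Form10

section Nijenhuis

variable {W : Type*} [NormedAddCommGroup W] [NormedSpace ℂ W]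
  {a : ∀ x : M, TangentSpace (𝓡 (2 * n)) x →L[ℝ] W} {x : M}
  {X Y : ∀ x : M, TangentSpace (𝓡 (2 * n)) x}

lemma mdifferentiableAt_Jfield (S : Structure n M)
    (hX : MDifferentiableAt (𝓡 (2 * n)) (𝓡 (2 * n)).tangent (T% X) x) :
    MDifferentiableAt (𝓡 (2 * n)) (𝓡 (2 * n)).tangent (T% (S.Jfield X)) x :=
  ((S.contMDiff_J x).mdifferentiableAt (by simp)).clm_bundle_apply hX

lemma mvfderiv_apply_Jfield
    (ha : MDifferentiableAt (𝓡 (2 * n))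
      ((𝓡 (2 * n)).prod 𝓘(ℝ, EuclideanSpace ℝ (Fin (2 * n)) →L[ℝ] W))
      (oneFormSection (𝓡 (2 * n)) a) x)
    (haJ : ∀ y v, a y (S.J y v) = Complex.I • a y v)
    (hX : MDifferentiableAt (𝓡 (2 * n)) (𝓡 (2 * n)).tangent (T% X) x)
    (v : TangentSpace (𝓡 (2 * n)) x) :
    mvfderiv (𝓡 (2 * n)) (fun y => a y (S.Jfield X y)) x v =
      Complex.I • mvfderiv (𝓡 (2 * n)) (fun y => a y (X y)) x v := by
  simp only [Jfield, haJ]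
  exact mvfderiv_clm_apply (Complex.I • ContinuousLinearMap.id ℝ W)
    ((mdifferentiableAt_totalSpace _ _).1 (ha.clm_bundle_apply hX)).2 v

lemma apply_nijenhuis_eq_zero
    (ha : MDifferentiableAt (𝓡 (2 * n))
      ((𝓡 (2 * n)).prod 𝓘(ℝ, EuclideanSpace ℝ (Fin (2 * n)) →L[ℝ] W))
      (oneFormSection (𝓡 (2 * n)) a) x)
    (haJ : ∀ y v, a y (S.J y v) = Complex.I • a y v)
    (hd : extD (𝓡 (2 * n)) (fun y => ContinuousAlternatingMap.ofSubsingleton ℝ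
      (TangentSpace (𝓡 (2 * n)) y) W (0 : Fin 1) (a y)) x = 0)
    (hX : MDifferentiableAt (𝓡 (2 * n)) (𝓡 (2 * n)).tangent (T% X) x)
    (hY : MDifferentiableAt (𝓡 (2 * n)) (𝓡 (2 * n)).tangent (T% Y) x) :
    a x (S.nijenhuis X Y x) = 0 := by
  have : IsManifold (𝓡 (2 * n)) 2 M := .of_le (n := ∞) (WithTop.coe_le_coe.2 le_top)
  have hJX := S.mdifferentiableAt_Jfield hX
  have hJY := S.mdifferentiableAt_Jfield hY
  rw [nijenhuis, map_sub, map_sub, map_sub, haJ, haJ, apply_mlieBracket ha hJX hJY,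
    apply_mlieBracket ha hJX hY, apply_mlieBracket ha hX hJY, apply_mlieBracket ha hX hY]
  simp only [hd, ContinuousAlternatingMap.coe_zero, Pi.zero_apply, sub_zero,
    mvfderiv_apply_Jfield ha haJ hX, mvfderiv_apply_Jfield ha haJ hY, smul_sub, smul_I_smul_I]
  abel

end Nijenhuis

section UnitaryCoframe

variable {ζ : Fin n → S.Form10}

/-- The forms `ζ₁, …, ζₙ` as a single one-form with values in `ℂⁿ`. -/
def coframeMap (ζ : Fin n → S.Form10) (x : M) :
    TangentSpace (𝓡 (2 * n)) x →L[ℝ] EuclideanSpace ℂ (Fin n) :=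
  ((EuclideanSpace.equiv (Fin n) ℂ).symm.toContinuousLinearMap.restrictScalars ℝ).comp
    (ContinuousLinearMap.pi fun i => (ζ i).toFun x)

lemma coframeMap_apply (ζ : Fin n → S.Form10) (x : M) (v : TangentSpace (𝓡 (2 * n)) x)
    (i : Fin n) : coframeMap ζ x v i = (ζ i).toFun x v := rfl

lemma coframeMap_J (ζ : Fin n → S.Form10) (x : M) (v : TangentSpace (𝓡 (2 * n)) x) :
    coframeMap ζ x (S.J x v) = Complex.I • coframeMap ζ x v := by
  ext i
  exact (ζ i).toFun_J x v

lemma contMDiff_coframeMap (ζ : Fin n → S.Form10) :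
    ContMDiff (𝓡 (2 * n)) ((𝓡 (2 * n)).prod
      𝓘(ℝ, EuclideanSpace ℝ (Fin (2 * n)) →L[ℝ] EuclideanSpace ℂ (Fin n))) ∞
      (oneFormSection (𝓡 (2 * n)) (coframeMap ζ)) := by
  have : IsManifold (𝓡 (2 * n)) 1 M := .of_le (n := ∞) (WithTop.coe_le_coe.2 le_top)
  intro x₀
  rw [contMDiffAt_oneFormSection_iff]
  let ι : Fin n → ℂ →L[ℝ] EuclideanSpace ℂ (Fin n) := fun i =>
    ((EuclideanSpace.equiv (Fin n) ℂ).symm.toContinuousLinearMap.restrictScalars ℝ).comp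
      (ContinuousLinearMap.single ℝ (fun _ : Fin n => ℂ) i)
  have hsum : ∀ x, coframeMap ζ x = ∑ i, (ι i).comp ((ζ i).toFun x) := fun x => by
    ext v i
    simp [ι, coframeMap, Pi.single_apply]
  simp only [hsum, ContinuousLinearMap.finsetSum_comp, ContinuousLinearMap.comp_assoc]
  exact contMDiffAt_finsetSum fun i _ => contMDiffAt_const.clm_comp
    (contMDiffAt_oneFormSection_iff.1 ((ζ i).contMDiff x₀))

lemma inner_eq_two_mul_re_inner_coframeMap (hζ : S.IsUnitaryCoframe ζ) (x : M)
    (v w : TangentSpace (𝓡 (2 * n)) x) :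
    S.g.inner x v w = 2 * (inner ℂ (coframeMap ζ x w) (coframeMap ζ x v)).re := by
  obtain ⟨Z, hdual, hunit⟩ := hζ x
  have h := apply_add_I_mul_apply_J_of_unitary (J := (S.J x).toLinearMap) (S.J_J x)
    (fun v w => congrArg Complex.ofReal (S.g_J_J x v w)) (fun i => (ζ i).type10 x) Z hdual hunit v w
  have hre := congrArg Complex.re h
  simpa [PiLp.inner_apply, coframeMap_apply, mul_comm] using hre

lemma fundamentalForm_eq (hζ : S.IsUnitaryCoframe ζ) (x : M) :
    S.fundamentalForm x = (hermitianForm _).compContinuousLinearMap (coframeMap ζ x) := by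
  ext v
  change S.g.inner x (S.J x (v 0)) (v 1) =
    2 * (inner ℂ (coframeMap ζ x (v 0)) (coframeMap ζ x (v 1))).im
  rw [← S.g.symm, inner_eq_two_mul_re_inner_coframeMap hζ, coframeMap_J, inner_smul_left]
  simp

lemma isInvertible_coframeMap (hζ : S.IsUnitaryCoframe ζ) (x : M) :
    (coframeMap ζ x).IsInvertible := by
  let f : EuclideanSpace ℝ (Fin (2 * n)) →L[ℝ] EuclideanSpace ℂ (Fin n) := coframeMap ζ x
  have hinj : Function.Injective f := by
    rw [injective_iff_map_eq_zero]
    intro v hv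
    by_contra hne
    have h := inner_eq_two_mul_re_inner_coframeMap hζ x v v
    rw [show coframeMap ζ x v = 0 from hv, inner_zero_left, Complex.zero_re, mul_zero] at h
    exact (S.g.pos x v hne).ne' h
  have hrank : Module.finrank ℝ (EuclideanSpace ℝ (Fin (2 * n))) =
      Module.finrank ℝ (EuclideanSpace ℂ (Fin n)) := by
    rw [finrank_real_of_complex, finrank_euclideanSpace_fin, finrank_euclideanSpace_fin]
  exact ⟨(LinearEquiv.ofInjectiveOfFinrankEq f.toLinearMap hinj hrank).toContinuousLinearEquiv,
    rfl⟩

lemma frameField_coframeMap_I_smul (hζ : S.IsUnitaryCoframe ζ) (u : EuclideanSpace ℂ (Fin n))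
    (x : M) : frameField (coframeMap ζ) (Complex.I • u) x =
      S.J x (frameField (coframeMap ζ) u x) := by
  have hinv := isInvertible_coframeMap hζ x
  rw [← frameField_apply hinv (S.J x _), coframeMap_J, apply_frameField hinv]

lemma d_apply_frameField_coframeMap (hζ : S.IsUnitaryCoframe ζ) (i : Fin n)
    (u v : EuclideanSpace ℂ (Fin n)) (x : M) :
    (ζ i).d x ![frameField (coframeMap ζ) u x, frameField (coframeMap ζ) v x] =
      -structureFunction (𝓡 (2 * n)) (coframeMap ζ) u v x i := by
  have : IsManifold (𝓡 (2 * n)) 2 M := .of_le (n := ∞) (WithTop.coe_le_coe.2 le_top)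
  have : IsManifold (𝓡 (2 * n)) 1 M := .of_le (n := 2) one_le_two
  have hX := mdifferentiableAt_frameField
    ((contMDiff_coframeMap ζ x).of_le (WithTop.coe_le_coe.2 le_top)) (isInvertible_coframeMap hζ x)
  have hconst : ∀ w y, (ζ i).toFun y (frameField (coframeMap ζ) w y) = w i := fun w y =>
    congrArg (· i) (apply_frameField (isInvertible_coframeMap hζ y) w)
  have h := apply_mlieBracket (((ζ i).contMDiff x).mdifferentiableAt (by simp)) (hX u) (hX v)
  simp only [hconst, mvfderiv_const, zero_apply, sub_zero, zero_sub] at h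
  exact neg_eq_iff_eq_neg.1 h.symm

theorem structureFunction_coframeMap_I_smul (hζ : S.IsUnitaryCoframe ζ)
    (hdel : ∀ i x, (ζ i).del x = 0) (hdelbar : ∀ i x, (ζ i).delbar x = 0)
    (u v : EuclideanSpace ℂ (Fin n)) (x : M) :
    structureFunction (𝓡 (2 * n)) (coframeMap ζ) (Complex.I • u) v x =
      -(Complex.I • structureFunction (𝓡 (2 * n)) (coframeMap ζ) u v x) := by
  ext i
  have h := Form10.d_apply_J (hdel i x) (hdelbar i x) (frameField (coframeMap ζ) u x)
    (frameField (coframeMap ζ) v x)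
  rw [← frameField_coframeMap_I_smul hζ, d_apply_frameField_coframeMap hζ,
    d_apply_frameField_coframeMap hζ, neg_inj] at h
  rw [h, PiLp.neg_apply, PiLp.smul_apply, smul_eq_mul, mul_neg]

theorem IsAlmostKahler.d_eq_zero (hS : S.IsAlmostKahler) (hζ : S.IsUnitaryCoframe ζ)
    (hdel : ∀ i x, (ζ i).del x = 0) (hdelbar : ∀ i x, (ζ i).delbar x = 0) (i : Fin n) (x : M) :
    (ζ i).d x = 0 := by
  have : IsManifold (𝓡 (2 * n)) 3 M := .of_le (n := ∞) (WithTop.coe_le_coe.2 le_top)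
  have hinv := isInvertible_coframeMap hζ
  have hΩ := hS x
  rw [funext (fundamentalForm_eq hζ)] at hΩ
  ext v
  have hv : v = ![frameField (coframeMap ζ) (coframeMap ζ x (v 0)) x,
      frameField (coframeMap ζ) (coframeMap ζ x (v 1)) x] := by
    ext j
    fin_cases j <;> exact (frameField_apply (hinv x) _).symm
  rw [hv, d_apply_frameField_coframeMap hζ, structureFunction_eq_zero
    ((contMDiff_coframeMap ζ).of_le (WithTop.coe_le_coe.2 le_top)) hinv
    (structureFunction_coframeMap_I_smul hζ hdel hdelbar) hΩ]
  exact neg_zero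

theorem IsUnitaryCoframe.isIntegrable (hζ : S.IsUnitaryCoframe ζ) (hd : ∀ i x, (ζ i).d x = 0) :
    S.IsIntegrable := by
  intro X Y hX hY x
  refine (isInvertible_coframeMap hζ x).injective ?_
  rw [map_zero]
  ext i
  exact apply_nijenhuis_eq_zero (((ζ i).contMDiff x).mdifferentiableAt (by simp)) (ζ i).toFun_J
    (hd i x) ((hX x).mdifferentiableAt (by simp)) ((hY x).mdifferentiableAt (by simp))

end UnitaryCoframe

end Structure

end AlmostHermitianStructure

end AlmostHermitian

theorem mainTheorem8_general {n : ℕ} {M : Type*} [TopologicalSpace M]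
    [ChartedSpace (EuclideanSpace ℝ (Fin (2 * n))) M] [IsManifold (𝓡 (2 * n)) ∞ M]
    (S : AlmostHermitian.Structure n M) (hS : S.IsAlmostKahler)
    (ζ : Fin n → S.Form10) (hζ : S.IsUnitaryCoframe ζ)
    (hdel : ∀ i x, (ζ i).del x = 0) (hdelbar : ∀ i x, (ζ i).delbar x = 0) :
    (∀ i x, (ζ i).d x = 0) ∧ S.IsKahler := by
  have hd := hS.d_eq_zero hζ hdel hdelbar
  exact ⟨hd, hζ.isIntegrable hd, hS⟩

theorem mainTheorem8 {n : ℕ} {M : Type*} [TopologicalSpace M] [T2Space M]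
    [ChartedSpace (EuclideanSpace ℝ (Fin (2 * n))) M] [IsManifold (𝓡 (2 * n)) ∞ M]
    (S : AlmostHermitian.Structure n M) (hS : S.IsAlmostKahler)
    (ζ : Fin n → S.Form10) (hζ : S.IsUnitaryCoframe ζ)
    (hdel : ∀ i x, (ζ i).del x = 0) (hdelbar : ∀ i x, (ζ i).delbar x = 0) :
    S.IsIntegrable ∧ S.IsKahler := by
  have h := (mainTheorem8_general S hS ζ hζ hdel hdelbar).2
  exact ⟨h.1, h⟩
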